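/- Theorem (generalized Kummer–Dedekind). For a domain $R$ write $K(R)$ for its fraction field, and for a local ring $R$ write $\hat R$ for its completion with respect to its maximal ideal. Let $(A,\mathfrak m)$ be a Noetherian local normal domain with fraction field $K$, let $L/K$ be a finite separable field extension, and let $B$ be the integral closure of $A$ in $L$. For each maximal ideal $\mathfrak m_i$ of $B$ lying over $\mathfrak m$, let $B_i=(B_{\mathfrak m_i})^{\wedge}$ be the completion of the local ring $B_{\mathfrak m_i}$. Assume that $\hat A$ and all the rings $B_i$ are domains. Let $\alpha\in B$ with $L=K(\alpha)$, and let $f\in A[x]$ be the minimal polynomial of $\alpha$ over $A$. Then: 1. $f$ is squarefree in $K(\hat A)[x]$. 2. For every $i$ the ring homomorphism $\hat A\to B_i$ induced by $A\to B_{\mathfrak m_i}$ is injective, so that $K(B_i)$ is a field extension of $K(\hat A)$. 3. There is a bijection $\mathfrak m_i\mapsto f_i$ from the set of maximal ideals of $B$ lying over $\mathfrak m$ to the set of monic irreducible factors of $f$ in $K(\hat A)[x]$ such that, for every $i$, there is a $K(\hat A)$-isomorphism $$K(B_i)\;\simeq\;K(\hat A)[x]/(f_i)$$ that sends the image of $\alpha$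 to the class of $x$. The bijection is uniquely determined by this property. -/

import Mathlib

noncomputable section

namespace LocalKummerDedekind

open IsLocalRing

/-- The completion of a local ring with respect to its maximal ideal. -/
abbrev LocalCompletion (R : Type*) [CommRing R] [IsLocalRing R] : Type _ :=
  AdicCompletion (maximalIdeal R) R

theorem maximalIdeal_pow_le_comap {R S : Type*} [CommRing R] [IsLocalRing R] [CommRing S]
    [IsLocalRing S] (φ : R →+* S) [IsLocalHom φ] (n : ℕ) :
    maximalIdeal R ^ n ≤ (maximalIdeal S ^ n).comap φ :=
  (Ideal.pow_right_mono (((local_hom_TFAE φ).out 0 3 : IsLocalHom φ ↔ _).mp inferInstance) n).trans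
    (Ideal.le_comap_pow φ n)

/-- The map `lim R / 𝔪_R ^ n → R / 𝔪_R ^ n → S / 𝔪_S ^ n` given by a local homomorphism. -/
def completionMapAux {R S : Type*} [CommRing R] [IsLocalRing R] [CommRing S] [IsLocalRing S]
    (φ : R →+* S) [IsLocalHom φ] (n : ℕ) : LocalCompletion R →+* S ⧸ maximalIdeal S ^ n :=
  (Ideal.quotientMap (maximalIdeal S ^ n) φ (maximalIdeal_pow_le_comap φ n)).comp
    (AdicCompletion.evalₐ (maximalIdeal R) n : LocalCompletion R →+* R ⧸ maximalIdeal R ^ n)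

theorem factorPow_comp_completionMapAux {R S : Type*} [CommRing R] [IsLocalRing R] [CommRing S]
    [IsLocalRing S] (φ : R →+* S) [IsLocalHom φ] {m n : ℕ} (hle : m ≤ n) :
    (Ideal.Quotient.factorPow (maximalIdeal S) hle).comp (completionMapAux φ n) =
      completionMapAux φ m := by
  ext x
  obtain ⟨r, rfl⟩ := AdicCompletion.mk_surjective (maximalIdeal R) R x
  simp only [completionMapAux, RingHom.comp_apply, RingHom.coe_coe, AdicCompletion.evalₐ_mk,
    Ideal.quotientMap_mk]
  have h := AdicCompletion.Ideal.mk_eq_mk (maximalIdeal R) hle r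
  rw [Ideal.Quotient.eq] at h
  refine (Ideal.Quotient.eq (I := maximalIdeal S ^ m)).2 ?_
  rw [← map_sub]
  exact maximalIdeal_pow_le_comap φ m h

/-- The ring homomorphism induced on completions by a local homomorphism `φ : R → S`: on
`lim R / 𝔪_R ^ n` it is the limit of the maps `R / 𝔪_R ^ n → S / 𝔪_S ^ n` induced by `φ`. -/
def completionMap {R S : Type*} [CommRing R] [IsLocalRing R] [CommRing S] [IsLocalRing S]
    (φ : R →+* S) [IsLocalHom φ] : LocalCompletion R →+* LocalCompletion S :=
  AdicCompletion.liftRingHom (maximalIdeal S) (completionMapAux φ)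
    (factorPow_comp_completionMapAux φ)

/-- `completionMap φ` extends `φ`. -/
theorem completionMap_algebraMap {R S : Type*} [CommRing R] [IsLocalRing R] [CommRing S]
    [IsLocalRing S] (φ : R →+* S) [IsLocalHom φ] (r : R) :
    completionMap φ (algebraMap R (LocalCompletion R) r) =
      algebraMap S (LocalCompletion S) (φ r) := by
  refine AdicCompletion.ext_evalₐ fun n => ?_
  rw [completionMap, AdicCompletion.evalₐ_liftRingHom (maximalIdeal S) (completionMapAux φ)
    (factorPow_comp_completionMapAux φ)]
  simp [completionMapAux, AdicCompletion.algebraMap_apply]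

/-- The maximal ideals of `B` lying over the maximal ideal of the local ring `A`. -/
abbrev MaximalIdealsOver (A B : Type*) [CommRing A] [IsLocalRing A] [CommRing B] [Algebra A B] :
    Type _ :=
  {P : Ideal B // P.IsMaximal ∧ P.LiesOver (maximalIdeal A)}

section

variable {A B : Type*} [CommRing A] [IsLocalRing A] [CommRing B] [Algebra A B]

instance (P : MaximalIdealsOver A B) : P.1.IsMaximal := P.2.1

instance (P : MaximalIdealsOver A B) : P.1.LiesOver (maximalIdeal A) := P.2.2

instance isLocalHom_algebraMap (P : MaximalIdealsOver A B) :
    IsLocalHom (algebraMap A (Localization.AtPrime P.1)) where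
  map_nonunit a ha := by
    by_contra h
    rw [IsScalarTower.algebraMap_apply A B (Localization.AtPrime P.1),
      IsLocalization.AtPrime.isUnit_to_map_iff (Localization.AtPrime P.1) P.1] at ha
    have h' : a ∈ maximalIdeal A := (mem_maximalIdeal a).2 h
    rw [P.2.2.over] at h'
    exact ha h'

/-- The completion of the local ring of `B` at `P`. -/
abbrev CompletionAt (P : MaximalIdealsOver A B) : Type _ :=
  LocalCompletion (Localization.AtPrime P.1)

/-- The homomorphism from the completion of `A` to the completion of `B` at `P` induced by the
local homomorphism `A → B_P`. -/
def toCompletionAt (P : MaximalIdealsOver A B) : LocalCompletion A →+* CompletionAt P :=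
  completionMap (algebraMap A (Localization.AtPrime P.1))

end

/-- The monic irreducible factors of a polynomial. -/
abbrev MonicIrreducibleFactors {F : Type*} [Field F] (f : Polynomial F) : Type _ :=
  {g : Polynomial F // g.Monic ∧ Irreducible g ∧ g ∣ f}

end LocalKummerDedekind

end

open LocalKummerDedekind

open LocalKummerDedekind

/-! Write `D` for the completion of `A`, `F` for its fraction field, `C P` for the completion of `B`
at `P` and `E P` for the fraction field of `C P`. Separability makes `B` finite over `A`, so `D ⊗[A]
B` is the `𝔪`-adic completion of `B`. The canonical maps `φ P : D ⊗[A] B → C P` are surjective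
(`tensorToCompletionAt_surjective`), jointly injective
(`eq_zero_of_forall_tensorToCompletionAt_eq_zero`), and have pairwise incomparable kernels
(`eq_of_ker_tensorToCompletionAt_le`).

The rest uses only these three facts. The kernels are prime with zero intersection and incomparable,
so each is a minimal prime. The tensor product is `D`-torsion-free by flatness, and a minimal prime
consists of zero divisors, so `D` embeds in `C P`.

Since `α` generates `L`, its image generates `E P` over `F`; put `f_P = minpoly F α`, computed in `E
P`. Equal minimal polynomials give an embedding `E P → E Q` matching the images of `α`, hence
comparable kernels and `P = Q`. Conversely, a monic irreducible factor `g` of `f` gives a map `D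
⊗[A] B → F[x]/(g)`; its kernel is prime, so it contains some `ker (φ P)`, the induced map `C P →
F[x]/(g)` is injective by integrality, and `g = f_P`. -/

theorem AdicCompletion.ofTensorProduct_bijective_of_finite {R : Type*} [CommRing R]
    [IsNoetherianRing R] (I : Ideal R) (M : Type*) [AddCommGroup M] [Module R M]
    [Module.Finite R M] : Function.Bijective (ofTensorProduct I M) := by
  obtain ⟨n, f, hf⟩ := Module.Finite.exists_fin' R M
  -- This quotient lives in the universe of `R`, which `M` need not do; naturality carries
  -- bijectivity back to `M`.
  let e : ((Fin n → R) ⧸ LinearMap.ker f) ≃ₗ[R] M := f.quotKerEquivOfSurjective hf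
  have h := ofTensorProduct_bijective_of_finite_of_isNoetherian I ((Fin n → R) ⧸ LinearMap.ker f)
  have hn := congrArg DFunLike.coe (ofTensorProduct_naturality I e.toLinearMap)
  rw [LinearMap.coe_comp, LinearMap.coe_comp] at hn
  have h1 : Function.Bijective (map I e.toLinearMap) := (congr I e).bijective
  have h2 : Function.Bijective
      (TensorProduct.AlgebraTensorModule.map (LinearMap.id : AdicCompletion I R →ₗ[AdicCompletion I R] _)
        e.toLinearMap) :=
    (TensorProduct.AlgebraTensorModule.congr (LinearEquiv.refl (AdicCompletion I R) _) e).bijective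
  exact (Function.Bijective.of_comp_iff _ h2).1 (hn ▸ h1.comp h)

namespace LocalKummerDedekind

open IsLocalRing

/-! ### Comparison of the `𝔪`-adic topology with the topologies of the primes over `𝔪` -/

section Noetherian

variable {A B : Type*} [CommRing A] [IsLocalRing A] [CommRing B] [Algebra A B]

instance [Module.Finite A B] : Finite (MaximalIdealsOver A B) :=
  ((Algebra.QuasiFinite.finite_primesOver (R := A) (S := B) (maximalIdeal A)).subset
    fun _ hP => ⟨hP.1.isPrime, hP.2⟩).to_subtype

/-- By integrality the primes containing `𝔪B` are exactly the given maximal ideals, so their product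
lies in the radical of `𝔪B` and a power of it in `𝔪B`. Distinct maximal ideals are comaximal, so the
product of their powers is the intersection. -/
theorem exists_forall_mem_pow_imp_mem_map_pow [Module.Finite A B] [IsNoetherianRing B] (n : ℕ) :
    ∃ N, n ≤ N ∧ ∀ b : B, (∀ P : MaximalIdealsOver A B, b ∈ P.1 ^ N) →
      b ∈ (maximalIdeal A).map (algebraMap A B) ^ n := by
  classical
  have := Fintype.ofFinite (MaximalIdealsOver A B)
  set I := (maximalIdeal A).map (algebraMap A B) with hI
  have h1 : ∏ P : MaximalIdealsOver A B, P.1 ≤ I.radical := by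
    rw [Ideal.radical_eq_sInf]
    refine le_sInf fun Q ⟨hQ, hQp⟩ => ?_
    have hm : maximalIdeal A ≤ Q.comap (algebraMap A B) := Ideal.map_le_iff_le_comap.1 hQ
    have hm' := (maximalIdeal.isMaximal A).eq_of_le (Ideal.comap_ne_top _ hQp.ne_top) hm
    have hl : Q.LiesOver (maximalIdeal A) := ⟨hm'⟩
    have hmax : Q.IsMaximal := Ideal.isMaximal_of_isIntegral_of_isMaximal_comap Q
      (hm' ▸ maximalIdeal.isMaximal A)
    exact Ideal.prod_le_inf.trans (Finset.inf_le (Finset.mem_univ (⟨Q, hmax, hl⟩ : MaximalIdealsOver A B)))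
  obtain ⟨k, hk⟩ := I.exists_radical_pow_le_of_fg (IsNoetherian.noetherian _)
  have hN : ∀ N, ∏ P : MaximalIdealsOver A B, P.1 ^ N = ⨅ P : MaximalIdealsOver A B, P.1 ^ N := by
    intro N
    rw [Ideal.prod_eq_iInf_of_pairwise_isCoprime]
    · simp
    · intro P _ Q _ hPQ
      refine (Ideal.isCoprime_of_isMaximal ?_).pow
      exact fun h => hPQ (Subtype.ext h)
  refine ⟨max n (k * n), le_max_left _ _, fun b hb => ?_⟩
  have hb' : b ∈ ⨅ P : MaximalIdealsOver A B, P.1 ^ (k * n) := by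
    rw [Ideal.mem_iInf]
    exact fun P => Ideal.pow_le_pow_right (le_max_right _ _) (hb P)
  rw [← hN, Finset.prod_pow, pow_mul] at hb'
  exact Ideal.pow_right_mono ((Ideal.pow_right_mono h1 k).trans hk) n hb'

/-- By integrality the maximal ideal of `B_P` is the only prime containing `𝔪B_P`, hence lies in its
radical. -/
theorem exists_maximalIdeal_pow_le_map [Algebra.IsIntegral A B] [IsNoetherianRing B]
    (P : MaximalIdealsOver A B) :
    ∃ k, maximalIdeal (Localization.AtPrime P.1) ^ k ≤
      (maximalIdeal A).map (algebraMap A (Localization.AtPrime P.1)) := by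
  set I := (maximalIdeal A).map (algebraMap A (Localization.AtPrime P.1)) with hI
  have : IsNoetherianRing (Localization.AtPrime P.1) :=
    IsLocalization.isNoetherianRing P.1.primeCompl _ inferInstance
  have h1 : maximalIdeal (Localization.AtPrime P.1) ≤ I.radical := by
    rw [Ideal.radical_eq_sInf]
    refine le_sInf fun Q ⟨hQ, hQp⟩ => ?_
    have hm : maximalIdeal A ≤ (Q.comap (algebraMap B _)).comap (algebraMap A B) := by
      rw [Ideal.comap_comap, ← IsScalarTower.algebraMap_eq]
      exact Ideal.map_le_iff_le_comap.1 hQ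
    have hQ' : (Q.comap (algebraMap B (Localization.AtPrime P.1))).IsPrime := inferInstance
    have hm' := (maximalIdeal.isMaximal A).eq_of_le (Ideal.comap_ne_top _ hQ'.ne_top) hm
    have hmax : (Q.comap (algebraMap B (Localization.AtPrime P.1))).IsMaximal :=
      Ideal.isMaximal_of_isIntegral_of_isMaximal_comap _ (hm' ▸ maximalIdeal.isMaximal A)
    have hle : Q.comap (algebraMap B (Localization.AtPrime P.1)) ≤ P.1 :=
      (Ideal.comap_mono (le_maximalIdeal hQp.ne_top)).trans
        (Localization.AtPrime.under_maximalIdeal (I := P.1)).le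
    rw [← Localization.AtPrime.map_eq_maximalIdeal]
    exact Ideal.map_le_iff_le_comap.2 (hmax.eq_of_le P.2.1.ne_top hle).ge
  obtain ⟨k, hk⟩ := I.exists_radical_pow_le_of_fg (IsNoetherian.noetherian _)
  exact ⟨k, (Ideal.pow_right_mono h1 k).trans hk⟩

end Noetherian

open scoped TensorProduct

/-! ### The maps from `D ⊗[A] B` to the completions of `B` -/

section Completion

variable {A B : Type*} [CommRing A] [IsLocalRing A] [CommRing B] [Algebra A B]

/-- `CompletionAt P` as an algebra over the completion of `A`, through `toCompletionAt P`. -/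
@[reducible]
noncomputable def completionAtAlgebra (P : MaximalIdealsOver A B) :
    Algebra (LocalCompletion A) (CompletionAt P) :=
  (toCompletionAt P).toAlgebra

attribute [local instance] completionAtAlgebra

instance (P : MaximalIdealsOver A B) :
    IsScalarTower A (LocalCompletion A) (CompletionAt P) :=
  IsScalarTower.of_algebraMap_eq fun a =>
    (IsScalarTower.algebraMap_apply A (Localization.AtPrime P.1) (CompletionAt P) a).trans
      (completionMap_algebraMap (algebraMap A (Localization.AtPrime P.1)) a).symm

instance (P : MaximalIdealsOver A B) : IsScalarTower A B (CompletionAt P) :=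
  IsScalarTower.of_algebraMap_eq fun a => by
    rw [IsScalarTower.algebraMap_apply A (Localization.AtPrime P.1) (CompletionAt P),
      IsScalarTower.algebraMap_apply A B (Localization.AtPrime P.1),
      ← IsScalarTower.algebraMap_apply B (Localization.AtPrime P.1) (CompletionAt P)]

/-- The canonical map from the base change of `B` to its completion at `P`. -/
noncomputable def tensorToCompletionAt (P : MaximalIdealsOver A B) :
    LocalCompletion A ⊗[A] B →ₐ[LocalCompletion A] CompletionAt P :=
  Algebra.TensorProduct.productLeftAlgHom (Algebra.ofId (LocalCompletion A) (CompletionAt P))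
    (IsScalarTower.toAlgHom A B (CompletionAt P))

@[simp]
theorem tensorToCompletionAt_one_tmul (P : MaximalIdealsOver A B) (b : B) :
    tensorToCompletionAt P (1 ⊗ₜ b) = algebraMap B (CompletionAt P) b := by
  simp [tensorToCompletionAt]

theorem isHausdorff_completionAt (P : MaximalIdealsOver A B) :
    IsHausdorff (maximalIdeal A) (CompletionAt P) :=
  IsHausdorff.of_map (J := maximalIdeal (Localization.AtPrime P.1)) <|
    Ideal.map_le_iff_le_comap.2 <| by
      simpa using maximalIdeal_pow_le_comap (algebraMap A (Localization.AtPrime P.1)) 1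

theorem evalₐ_algebraMap_completionAt (P : MaximalIdealsOver A B) (n : ℕ) (b : B) :
    AdicCompletion.evalₐ (maximalIdeal (Localization.AtPrime P.1)) n
        (algebraMap B (CompletionAt P) b) =
      IsLocalization.AtPrime.equivQuotMaximalIdealPow P.1 (Localization.AtPrime P.1) n
        (Ideal.Quotient.mk _ b) := by
  rw [IsScalarTower.algebraMap_apply B (Localization.AtPrime P.1) (CompletionAt P)]
  simp [AdicCompletion.algebraMap_apply]

theorem ideal_pow_smul_top_le_ker_evalₐ (P : MaximalIdealsOver A B) (n : ℕ) {x : CompletionAt P}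
    (hx : x ∈ (maximalIdeal A ^ n • ⊤ : Submodule A (CompletionAt P))) :
    AdicCompletion.evalₐ (maximalIdeal (Localization.AtPrime P.1)) n x = 0 := by
  refine Submodule.smul_induction_on hx (fun a ha y _ => ?_) (fun y z hy hz => ?_)
  · rw [Algebra.smul_def, map_mul,
      IsScalarTower.algebraMap_apply A (Localization.AtPrime P.1) (CompletionAt P)]
    have : algebraMap A (Localization.AtPrime P.1) a ∈
        maximalIdeal (Localization.AtPrime P.1) ^ n :=
      maximalIdeal_pow_le_comap (algebraMap A (Localization.AtPrime P.1)) n ha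
    rw [AlgHom.commutes, Ideal.Quotient.algebraMap_eq, Ideal.Quotient.eq_zero_iff_mem.2 this,
      zero_mul]
  · rw [map_add, hy, hz, add_zero]

/-- Surjectivity modulo `𝔪`, the input for the complete form of Nakayama's lemma. Already `B`
surjects onto `B_P / 𝔪_P ^ k`, and for large `k` the remaining error lies in `𝔪 • C P`. -/
theorem exists_sub_algebraMap_mem_smul_top [Algebra.IsIntegral A B] [IsNoetherianRing B]
    (P : MaximalIdealsOver A B) (x : CompletionAt P) :
    ∃ b : B, x - algebraMap B (CompletionAt P) b ∈
      (maximalIdeal A • ⊤ : Submodule A (CompletionAt P)) := by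
  have : IsNoetherianRing (Localization.AtPrime P.1) :=
    IsLocalization.isNoetherianRing P.1.primeCompl _ inferInstance
  obtain ⟨k, hk⟩ := exists_maximalIdeal_pow_le_map P
  obtain ⟨q, hq⟩ := (IsLocalization.AtPrime.equivQuotMaximalIdealPow P.1
    (Localization.AtPrime P.1) k).surjective
      (AdicCompletion.evalₐ (maximalIdeal (Localization.AtPrime P.1)) k x)
  obtain ⟨b, rfl⟩ := Ideal.Quotient.mk_surjective q
  refine ⟨b, ?_⟩
  have h0 : AdicCompletion.evalₐ (maximalIdeal (Localization.AtPrime P.1)) k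
      (x - algebraMap B (CompletionAt P) b) = 0 := by
    rw [map_sub, evalₐ_algebraMap_completionAt, hq, sub_self]
  have h1 : AdicCompletion.eval (maximalIdeal (Localization.AtPrime P.1)) _ k
      (x - algebraMap B (CompletionAt P) b) = 0 := by
    rw [← AdicCompletion.factor_evalₐ_eq_eval _ _ (by simp), h0, map_zero]
  have h2 := (AdicCompletion.pow_smul_top_eq_ker_eval (M := Localization.AtPrime P.1) (n := k)
    (IsNoetherian.noetherian (maximalIdeal (Localization.AtPrime P.1)))).ge h1
  refine Submodule.smul_induction_on (Submodule.smul_mono_left hk h2) (fun r hr y _ => ?_)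
    (fun y z hy hz => add_mem hy hz)
  -- Passes from the ideal of `B_P` generated by `𝔪` to scalars in `𝔪` itself.
  refine Submodule.span_induction (p := fun r _ => r • y ∈ _) ?_ ?_ ?_ ?_ hr
  · rintro _ ⟨a, ha, rfl⟩
    rw [algebraMap_smul]
    exact Submodule.smul_mem_smul ha trivial
  · simp
  · intro r s _ _ hr hs
    rw [add_smul]
    exact add_mem hr hs
  · intro s r _ hr
    rw [smul_assoc]
    refine Submodule.smul_induction_on hr (fun a ha z _ => ?_) (fun z w hz hw => ?_)
    · rw [smul_comm]
      exact Submodule.smul_mem_smul ha trivial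
    · rw [smul_add]
      exact add_mem hz hw

section Finite

variable [IsNoetherianRing A] [Module.Finite A B]

variable (A B) in
/-- The base change of `B` to the completion of `A` is the completion of the module `B`. -/
noncomputable def tensorEquivAdicCompletion :
    LocalCompletion A ⊗[A] B ≃ₗ[LocalCompletion A] AdicCompletion (maximalIdeal A) B :=
  LinearEquiv.ofBijective _
    (AdicCompletion.ofTensorProduct_bijective_of_finite (maximalIdeal A) B)

theorem tensorEquivAdicCompletion_symm_of (b : B) :
    (tensorEquivAdicCompletion A B).symm (AdicCompletion.of (maximalIdeal A) B b) = 1 ⊗ₜ b := by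
  rw [LinearEquiv.symm_apply_eq]
  simp [tensorEquivAdicCompletion]

theorem tensorToCompletionAt_surjective (P : MaximalIdealsOver A B) :
    Function.Surjective (tensorToCompletionAt P) := by
  have : IsNoetherianRing B := IsNoetherianRing.of_finite A B
  have := isHausdorff_completionAt P
  have := AdicCompletion.isAdicComplete (M := B) (IsNoetherian.noetherian (maximalIdeal A))
  let f : AdicCompletion (maximalIdeal A) B →ₗ[A] CompletionAt P :=
    ((tensorToCompletionAt P).toLinearMap.comp
      (tensorEquivAdicCompletion A B).symm.toLinearMap).restrictScalars A
  have hf : Function.Surjective f := by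
    -- The source is `𝔪`-adically complete and the target Hausdorff, so surjectivity modulo `𝔪`
    -- suffices.
    refine surjective_of_mkQ_comp_surjective (I := maximalIdeal A) fun y => ?_
    obtain ⟨x, rfl⟩ := Submodule.mkQ_surjective _ y
    obtain ⟨b, hb⟩ := exists_sub_algebraMap_mem_smul_top P x
    refine ⟨AdicCompletion.of _ _ b, ((Submodule.Quotient.eq _).2 ?_).symm⟩
    simpa [f, tensorEquivAdicCompletion_symm_of] using hb
  exact fun x => (hf x).imp' _ fun _ h => h

theorem eq_zero_of_forall_tensorToCompletionAt_eq_zero (z : LocalCompletion A ⊗[A] B)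
    (hz : ∀ P : MaximalIdealsOver A B, tensorToCompletionAt P z = 0) : z = 0 := by
  have : IsNoetherianRing B := IsNoetherianRing.of_finite A B
  obtain ⟨w, rfl⟩ := (tensorEquivAdicCompletion A B).symm.surjective z
  rw [map_eq_zero_iff _ (LinearEquiv.injective _)]
  refine AdicCompletion.ext fun {n} => ?_
  obtain ⟨N, hnN, hN⟩ := exists_forall_mem_pow_imp_mem_map_pow (A := A) (B := B) n
  obtain ⟨b, hb⟩ := Submodule.mkQ_surjective _ (w.val N)
  -- Approximate `w` by `b` modulo `𝔪 ^ N`. Since `w` dies in every `C P`, `b` lies in every `P ^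
  -- N`, hence in `𝔪 ^ n B`; as `n ≤ N`, the component of `w` at level `n` is the class of `b`,
  -- which is zero.
  have hw : w - AdicCompletion.of _ _ b ∈
      (maximalIdeal A ^ N • ⊤ : Submodule A (AdicCompletion (maximalIdeal A) B)) := by
    rw [AdicCompletion.pow_smul_top_eq_ker_eval (IsNoetherian.noetherian (maximalIdeal A))]
    simp [LinearMap.mem_ker, ← hb]
  have hbn : b ∈ (maximalIdeal A).map (algebraMap A B) ^ n := by
    refine hN b fun P => ?_
    let f : AdicCompletion (maximalIdeal A) B →ₗ[A] CompletionAt P :=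
      ((tensorToCompletionAt P).toLinearMap.comp
        (tensorEquivAdicCompletion A B).symm.toLinearMap).restrictScalars A
    have h1 := Submodule.mem_map_of_mem (f := f) hw
    rw [Submodule.map_smul''] at h1
    have h2 := ideal_pow_smul_top_le_ker_evalₐ P N (Submodule.smul_mono le_rfl le_top h1)
    have h3 : f (w - AdicCompletion.of _ _ b) = - algebraMap B (CompletionAt P) b := by
      rw [map_sub]
      simp [f, tensorEquivAdicCompletion_symm_of, hz P]
    rw [h3, map_neg, neg_eq_zero, evalₐ_algebraMap_completionAt, EmbeddingLike.map_eq_zero_iff,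
      Ideal.Quotient.eq_zero_iff_mem] at h2
    exact h2
  have hwn : w.val n = Submodule.mkQ _ b := by
    rw [← AdicCompletion.transitionMap_comp_eval_apply _ _ hnN w, ← hb]
    rfl
  rw [hwn, AdicCompletion.val_zero_apply, Submodule.mkQ_apply, Submodule.Quotient.mk_eq_zero,
    Ideal.smul_top_eq_map, Ideal.map_pow]
  exact hbn

/-- An inclusion of kernels yields a map `C P → C Q` over `B`. It preserves units, and the elements
of `B` that become units in `C P` are those outside `P`; thus `Q ≤ P`. -/
theorem eq_of_ker_tensorToCompletionAt_le {P Q : MaximalIdealsOver A B}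
    (h : RingHom.ker (tensorToCompletionAt P) ≤ RingHom.ker (tensorToCompletionAt Q)) :
    P = Q := by
  have : IsNoetherianRing B := IsNoetherianRing.of_finite A B
  have hN : ∀ P : MaximalIdealsOver A B, IsNoetherianRing (Localization.AtPrime P.1) :=
    fun P => IsLocalization.isNoetherianRing P.1.primeCompl _ inferInstance
  have hu : ∀ (P : MaximalIdealsOver A B) (b : B),
      IsUnit (algebraMap B (CompletionAt P) b) ↔ b ∉ P.1 := by
    intro P b
    rw [IsScalarTower.algebraMap_apply B (Localization.AtPrime P.1) (CompletionAt P),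
      isUnit_map_iff, IsLocalization.AtPrime.isUnit_to_map_iff (Localization.AtPrime P.1) P.1]
    rfl
  let g := AlgHom.liftOfSurjective (tensorToCompletionAt P) (tensorToCompletionAt_surjective P)
    (tensorToCompletionAt Q) h
  have hg : ∀ b : B, g (algebraMap B (CompletionAt P) b) = algebraMap B (CompletionAt Q) b := by
    intro b
    rw [← tensorToCompletionAt_one_tmul, ← tensorToCompletionAt_one_tmul]
    exact AlgHom.liftOfSurjective_apply ..
  refine Subtype.ext (Q.2.1.eq_of_le P.2.1.ne_top fun b hb => ?_).symm
  by_contra hbP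
  exact (hu Q b).1 (hg b ▸ ((hu P b).2 hbP).map g) hb

end Finite

end Completion

open scoped Polynomial nonZeroDivisors

/-! ### Quotients of a base change: integrality, torsion and minimal primes -/

theorem minpoly_dvd_map_minpoly {A B D F C E : Type*} [CommRing A] [CommRing B] [Algebra A B]
    [CommRing D] [Algebra A D] [Field F] [Algebra D F] [Algebra A F] [IsScalarTower A D F]
    [CommRing C] [Algebra D C] [Field E] [Algebra C E] [Algebra D E] [IsScalarTower D C E]
    [Algebra F E] [IsScalarTower D F E] (φ : D ⊗[A] B →ₐ[D] C) (α : B) :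
    minpoly F (algebraMap C E (φ (1 ⊗ₜ α))) ∣ (minpoly A α).map (algebraMap A F) := by
  let ψ : D ⊗[A] B →ₐ[D] E := (IsScalarTower.toAlgHom D C E).comp φ
  have h : Polynomial.aeval (1 ⊗ₜ α : D ⊗[A] B) (minpoly A α) = 0 := by
    have := Polynomial.aeval_algHom_apply
      (Algebra.TensorProduct.includeRight : B →ₐ[A] D ⊗[A] B) α (minpoly A α)
    rw [minpoly.aeval, map_zero] at this
    exact this
  refine minpoly.dvd _ _ ?_
  rw [IsScalarTower.algebraMap_eq A D F, ← Polynomial.map_map, Polynomial.aeval_map_algebraMap]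
  change Polynomial.aeval (ψ (1 ⊗ₜ α)) _ = 0
  rw [Polynomial.aeval_algHom_apply, Polynomial.aeval_map_algebraMap, h, map_zero]

theorem isIntegral_algebraMap_apply_one_tmul {A B D F C E : Type*} [CommRing A] [CommRing B] [Algebra A B]
    [CommRing D] [Algebra A D] [Field F] [Algebra D F] [Algebra.IsIntegral A B]
    [CommRing C] [Algebra D C] [Field E] [Algebra C E] [Algebra D E] [IsScalarTower D C E]
    [Algebra F E] [IsScalarTower D F E] (φ : D ⊗[A] B →ₐ[D] C) (α : B) :
    IsIntegral F (algebraMap C E (φ (1 ⊗ₜ α))) := by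
  have h : IsIntegral D (1 ⊗ₜ α : D ⊗[A] B) := Algebra.IsIntegral.isIntegral _
  exact (h.map ((IsScalarTower.toAlgHom D C E).comp φ)).tower_top

/-- Base change along a flat algebra preserves torsion-freeness over a domain: the case of an
algebra embedded in an extension of the fraction field. -/
theorem isTorsionFree_tensorProduct_of_flat {A K L B D : Type*} [CommRing A] [Field K]
    [Algebra A K] [IsFractionRing A K] [Field L] [Algebra K L] [Algebra A L]
    [IsScalarTower A K L] [CommRing B] [Algebra A B] [Algebra B L] [IsScalarTower A B L]
    (hBL : Function.Injective (algebraMap B L)) [CommRing D] [IsDomain D] [Algebra A D]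
    [Module.Flat A D] : Module.IsTorsionFree D (D ⊗[A] B) := by
  have : Module.Flat A K := IsLocalization.flat K A⁰
  have : Module.Flat A L := Module.Flat.trans A K L
  have hL : Module.IsTorsionFree D (D ⊗[A] L) := inferInstance
  have hi : Function.Injective
      (TensorProduct.AlgebraTensorModule.map (LinearMap.id : D →ₗ[D] D)
        (IsScalarTower.toAlgHom A B L).toLinearMap) :=
    Module.Flat.lTensor_preserves_injective_linearMap (M := D)
      (IsScalarTower.toAlgHom A B L).toLinearMap hBL
  exact hi.moduleIsTorsionFree _ fun c x => map_smul _ c x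

/-- If a torsion-free algebra over a domain embeds in a finite product of domains that are pairwise
incomparable quotients of it, then the base domain embeds in each of them. -/
theorem algebraMap_injective_of_iInf_ker_eq_bot {D R ι : Type*} [Finite ι] {C : ι → Type*}
    [CommRing D] [IsDomain D] [CommRing R] [Algebra D R] [Module.IsTorsionFree D R]
    [∀ i, CommRing (C i)] [∀ i, IsDomain (C i)] [∀ i, Algebra D (C i)]
    (φ : ∀ i, R →ₐ[D] C i) (hinj : ∀ z, (∀ i, φ i z = 0) → z = 0)
    (hsep : ∀ i j, RingHom.ker (φ i) ≤ RingHom.ker (φ j) → i = j) (i : ι) :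
    Function.Injective (algebraMap D (C i)) := by
  have := Fintype.ofFinite ι
  have : (RingHom.ker (φ i)).IsPrime := RingHom.ker_isPrime _
  obtain ⟨p, hp, hpi⟩ := Ideal.exists_minimalPrimes_le (bot_le : ⊥ ≤ RingHom.ker (φ i))
  have hle : Finset.univ.inf (fun j => RingHom.ker (φ j)) ≤ p := fun z hz => by
    rw [hinj z fun j => Submodule.mem_finsetInf.1 hz j (Finset.mem_univ j)]
    exact p.zero_mem
  -- A prime containing a finite intersection contains one of its members; incomparability then
  -- forces `j = i`, so `ker (φ i)` is the minimal prime `p`.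
  obtain ⟨j, -, hj⟩ := (Ideal.IsPrime.inf_le' hp.1.1).1 hle
  obtain rfl := hsep j i (hj.trans hpi)
  rw [injective_iff_map_eq_zero]
  intro d hd
  by_contra hd0
  have hdp : algebraMap D R d ∈ p := hj <| by
    rw [RingHom.mem_ker, AlgHom.commutes, hd]
  refine Set.disjoint_left.1 (Ideal.disjoint_nonZeroDivisors_of_mem_minimalPrimes hp) hdp ?_
  rw [SetLike.mem_coe, mem_nonZeroDivisors_iff_right]
  intro x hx
  rw [mul_comm, ← Algebra.smul_def] at hx
  exact (smul_eq_zero_iff_right hd0).1 hx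

/-! ### Homomorphisms out of `B` and the generator `α` -/

section Generator

variable {A K L B : Type*} [CommRing A] [IsDomain A] [Field K] [Algebra A K] [IsFractionRing A K]
  [Field L] [Algebra K L] [Algebra A L] [IsScalarTower A K L]
  [CommRing B] [Algebra A B] [Algebra B L] [IsScalarTower A B L]

/-- Normality identifies the minimal polynomials over `A` and over `K`. The one over `K` is
separable, a property which, unlike squarefreeness, survives every field extension. -/
theorem squarefree_map_minpoly [IsIntegrallyClosed A] [Algebra.IsSeparable K L]
    (hBL : Function.Injective (algebraMap B L)) [Algebra.IsIntegral A B] (α : B)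
    {F : Type*} [Field F] [Algebra A F] (hAF : Function.Injective (algebraMap A F)) :
    Squarefree ((minpoly A α).map (algebraMap A F)) := by
  have : IsDomain B := hBL.isDomain
  have hmin := minpoly.isIntegrallyClosed_eq_field_fractions K L
    (Algebra.IsIntegral.isIntegral (R := A) α)
  have hsep : (minpoly K (algebraMap B L α)).Separable := Algebra.IsSeparable.isSeparable K _
  have h := (hsep.map (f := IsFractionRing.lift (K := K) hAF)).squarefree
  have hcomp : (IsFractionRing.lift (K := K) hAF).comp (algebraMap A K) =
      algebraMap A F := RingHom.ext (IsFractionRing.lift_algebraMap hAF)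
  rwa [hmin, Polynomial.map_map, hcomp] at h

variable [FiniteDimensional K L]

/-- Write `b` as a polynomial in `α` over `K` and clear denominators. Questions about `B` thereby
reduce to `α` whenever nonzero elements of `A` can be cancelled. -/
theorem exists_smul_eq_aeval (hBL : Function.Injective (algebraMap B L)) {α : B}
    (hα : IntermediateField.adjoin K {algebraMap B L α} = ⊤) (b : B) :
    ∃ s : A, s ≠ 0 ∧ ∃ q : A[X], s • b = Polynomial.aeval α q := by
  have hb : algebraMap B L b ∈ (IntermediateField.adjoin K {algebraMap B L α}).toSubalgebra := by
    rw [hα]; trivial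
  rw [IntermediateField.adjoin_simple_toSubalgebra_of_isAlgebraic
    (Algebra.IsAlgebraic.isAlgebraic _), Algebra.adjoin_singleton_eq_range_aeval] at hb
  obtain ⟨p, hp⟩ := hb
  obtain ⟨s, hs, h⟩ := IsLocalization.integerNormalization_spec A⁰ p
  refine ⟨s, nonZeroDivisors.ne_zero hs,
    IsLocalization.integerNormalization A⁰ p, hBL ?_⟩
  have h' := congrArg (Polynomial.aeval (algebraMap B L α)) h
  rw [Polynomial.aeval_map_algebraMap, Polynomial.aeval_algebraMap_apply,
    ← algebraMap_smul K s p, map_smul, algebraMap_smul] at h'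
  rw [h', Algebra.smul_def, map_mul, ← hp, ← IsScalarTower.algebraMap_apply, Algebra.smul_def]
  rfl

theorem algHom_ext_of_adjoin_eq_top (hBL : Function.Injective (algebraMap B L)) {α : B}
    (hα : IntermediateField.adjoin K {algebraMap B L α} = ⊤) {E : Type*} [CommRing E] [IsDomain E]
    [Algebra A E] (hAE : Function.Injective (algebraMap A E)) {φ ψ : B →ₐ[A] E}
    (h : φ α = ψ α) : φ = ψ := by
  ext b
  obtain ⟨s, hs, q, hq⟩ := exists_smul_eq_aeval (A := A) hBL hα b
  have h1 : s • φ b = s • ψ b := by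
    rw [← map_smul, ← map_smul, hq, ← Polynomial.aeval_algHom_apply, h,
      Polynomial.aeval_algHom_apply]
  rw [Algebra.smul_def, Algebra.smul_def] at h1
  exact mul_left_cancel₀ ((map_ne_zero_iff _ hAE).2 hs) h1

/-- An algebra homomorphism out of `B` is obtained by choosing a root of the minimal polynomial of
a generator of the fraction field of `B`. -/
theorem exists_algHom_apply_eq [IsIntegrallyClosed A] (hBL : Function.Injective (algebraMap B L))
    [Algebra.IsIntegral A B] {α : B} (hα : IntermediateField.adjoin K {algebraMap B L α} = ⊤)
    {E : Type*} [Field E] [Algebra A E] (hAE : Function.Injective (algebraMap A E)) {x : E}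
    (hx : Polynomial.aeval x (minpoly A α) = 0) : ∃ φ : B →ₐ[A] E, φ α = x := by
  have : IsDomain B := hBL.isDomain
  let : Algebra K E := (IsFractionRing.lift (K := K) hAE).toAlgebra
  have : IsScalarTower A K E := IsScalarTower.of_algebraMap_eq fun a =>
    (IsFractionRing.lift_algebraMap hAE a).symm
  have hmin := minpoly.isIntegrallyClosed_eq_field_fractions K L
    (Algebra.IsIntegral.isIntegral (R := A) α)
  have hadj : Algebra.adjoin K {algebraMap B L α} = ⊤ := by
    rw [← IntermediateField.adjoin_simple_toSubalgebra_of_isAlgebraic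
      (Algebra.IsAlgebraic.isAlgebraic _), hα]
    rfl
  let pb := PowerBasis.ofAdjoinEqTop (Algebra.IsIntegral.isIntegral (R := K) _) hadj
  have hpb : pb.gen = algebraMap B L α := PowerBasis.ofAdjoinEqTop_gen ..
  have hroot : Polynomial.aeval x (minpoly K pb.gen) = 0 := by
    rw [hpb, hmin, Polynomial.aeval_map_algebraMap, hx]
  refine ⟨((pb.lift x hroot).restrictScalars A).comp (IsScalarTower.toAlgHom A B L), ?_⟩
  change pb.lift x hroot (algebraMap B L α) = x
  rw [← hpb, PowerBasis.lift_gen]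

end Generator

/-! ### Minimal polynomials of the images of `α` -/

section BaseChange

variable {A K L B D F : Type*} [CommRing A] [IsDomain A]
  [Field K] [Algebra A K] [IsFractionRing A K]
  [Field L] [Algebra K L] [Algebra A L] [IsScalarTower A K L] [FiniteDimensional K L]
  [CommRing B] [Algebra A B] [Algebra B L] [IsScalarTower A B L]
  [CommRing D] [Algebra A D] [Field F] [Algebra D F] [IsFractionRing D F]

theorem tensorProduct_algHom_ext (hBL : Function.Injective (algebraMap B L)) {α : B}
    (hα : IntermediateField.adjoin K {algebraMap B L α} = ⊤)
    {E : Type*} [CommRing E] [IsDomain E] [Algebra A E] [Algebra D E] [IsScalarTower A D E]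
    (hAE : Function.Injective (algebraMap A E))
    {φ ψ : D ⊗[A] B →ₐ[D] E} (h : φ (1 ⊗ₜ α) = ψ (1 ⊗ₜ α)) : φ = ψ :=
  Algebra.TensorProduct.ext (by ext) <| algHom_ext_of_adjoin_eq_top hBL hα hAE h

section Single

variable {C E : Type*} [CommRing C] [Algebra D C]
  [Field E] [Algebra C E] [IsFractionRing C E] [Algebra D E] [IsScalarTower D C E]
  [Algebra F E] [IsScalarTower D F E]

/-- Elements of `E` are fractions of images of `D ⊗[A] B`, and up to a nonzero factor from `A` each
element of `B` is a polynomial in `α`. -/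
theorem adjoin_eq_top_of_surjective (hBL : Function.Injective (algebraMap B L)) {α : B}
    (hα : IntermediateField.adjoin K {algebraMap B L α} = ⊤)
    (hAD : Function.Injective (algebraMap A D))
    {φ : D ⊗[A] B →ₐ[D] C} (hφ : Function.Surjective φ) :
    IntermediateField.adjoin F {algebraMap C E (φ (1 ⊗ₜ α))} = ⊤ := by
  set T := IntermediateField.adjoin F {algebraMap C E (φ (1 ⊗ₜ α))} with hT
  have hD : ∀ d, algebraMap D E d ∈ T := fun d => by
    rw [IsScalarTower.algebraMap_apply D F E]
    exact T.algebraMap_mem _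
  let g : B →+* E := (algebraMap C E).comp
    ((φ : D ⊗[A] B →+* C).comp (Algebra.TensorProduct.includeRight : B →ₐ[A] D ⊗[A] B))
  have hg : ∀ a : A, g (algebraMap A B a) = algebraMap D E (algebraMap A D a) := fun a => by
    simp only [g, RingHom.comp_apply, RingHom.coe_coe, AlgHom.commutes]
    rw [IsScalarTower.algebraMap_apply A D (D ⊗[A] B), AlgHom.commutes,
      ← IsScalarTower.algebraMap_apply]
  have hDE : Function.Injective (algebraMap D E) := by
    rw [IsScalarTower.algebraMap_eq D F E]
    exact (algebraMap F E).injective.comp (IsFractionRing.injective D F)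
  have hB : ∀ b, g b ∈ T := fun b => by
    obtain ⟨s, hs, q, hq⟩ := exists_smul_eq_aeval (A := A) hBL hα b
    have h1 : g (s • b) ∈ T := by
      rw [hq, Polynomial.aeval_eq_sum_range, map_sum]
      refine sum_mem fun i _ => ?_
      rw [Algebra.smul_def, map_mul, map_pow, hg]
      exact mul_mem (hD _) (pow_mem (IntermediateField.mem_adjoin_simple_self F _) i)
    rw [Algebra.smul_def, map_mul, hg] at h1
    have hs' : algebraMap D E (algebraMap A D s) ≠ 0 :=
      (map_ne_zero_iff _ hDE).2 ((map_ne_zero_iff _ hAD).2 hs)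
    rw [← mul_div_cancel_left₀ (g b) hs']
    exact div_mem h1 (hD _)
  have hC : ∀ c, algebraMap C E c ∈ T := fun c => by
    obtain ⟨z, rfl⟩ := hφ c
    induction z with
    | zero => simp
    | add x y hx hy => rw [map_add, map_add]; exact add_mem hx hy
    | tmul d b =>
      have : d ⊗ₜ[A] b = d • (1 ⊗ₜ[A] b) := by simp [TensorProduct.smul_tmul']
      rw [this, map_smul, Algebra.smul_def, map_mul, ← IsScalarTower.algebraMap_apply D C E]
      exact mul_mem (hD d) (hB b)
  refine eq_top_iff.2 fun x _ => ?_
  obtain ⟨a, b, -, rfl⟩ := IsFractionRing.div_surjective (A := C) x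
  exact div_mem (hC a) (hC b)

end Single

section Family

variable [Algebra.IsIntegral A B]
  {ι : Type*} {C E : ι → Type*} [∀ i, CommRing (C i)]
  [∀ i, Algebra D (C i)] [∀ i, Field (E i)] [∀ i, Algebra (C i) (E i)]
  [∀ i, IsFractionRing (C i) (E i)] [∀ i, Algebra D (E i)] [∀ i, IsScalarTower D (C i) (E i)]
  [∀ i, Algebra F (E i)] [∀ i, IsScalarTower D F (E i)]

theorem minpoly_injective_of_ker_le (hBL : Function.Injective (algebraMap B L)) {α : B}
    (hα : IntermediateField.adjoin K {algebraMap B L α} = ⊤)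
    (hAD : Function.Injective (algebraMap A D))
    (φ : ∀ i, D ⊗[A] B →ₐ[D] C i) (hφ : ∀ i, Function.Surjective (φ i))
    (hsep : ∀ i j, RingHom.ker (φ i) ≤ RingHom.ker (φ j) → i = j) :
    Function.Injective fun i => minpoly F (algebraMap (C i) (E i) (φ i (1 ⊗ₜ α))) := by
  intro i j hij
  let x := fun i => algebraMap (C i) (E i) (φ i (1 ⊗ₜ α))
  have hadj : Algebra.adjoin F {x i} = ⊤ := by
    rw [← IntermediateField.adjoin_simple_toSubalgebra_of_isAlgebraic
      (isIntegral_algebraMap_apply_one_tmul (φ i) α).isAlgebraic,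
      adjoin_eq_top_of_surjective hBL hα hAD (hφ i)]
    rfl
  let pb := PowerBasis.ofAdjoinEqTop (isIntegral_algebraMap_apply_one_tmul (F := F) (φ i) α) hadj
  have hpb : pb.gen = x i := PowerBasis.ofAdjoinEqTop_gen ..
  let e : E i →ₐ[F] E j := pb.lift (x j) <| by
    rw [hpb, show minpoly F (x i) = minpoly F (x j) from hij, minpoly.aeval]
  have he : e (x i) = x j := by rw [← hpb]; exact pb.lift_gen ..
  let ψ : ∀ i, D ⊗[A] B →ₐ[D] E i := fun i => (IsScalarTower.toAlgHom D (C i) (E i)).comp (φ i)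
  let : Algebra A (E j) := ((algebraMap D (E j)).comp (algebraMap A D)).toAlgebra
  have : IsScalarTower A D (E j) := IsScalarTower.of_algebraMap_eq fun _ => rfl
  have hDE : Function.Injective (algebraMap D (E j)) := by
    rw [IsScalarTower.algebraMap_eq D F (E j)]
    exact (algebraMap F (E j)).injective.comp (IsFractionRing.injective D F)
  -- A `D`-algebra map from `D ⊗[A] B` to a field containing `A` is determined by the image of `α`.
  have h : (e.restrictScalars D).comp (ψ i) = ψ j :=
    tensorProduct_algHom_ext hBL hα (show Function.Injective (algebraMap A (E j)) from hDE.comp hAD) he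
  refine hsep i j fun z hz => IsFractionRing.injective (C j) (E j) ?_
  rw [map_zero]
  change ψ j z = 0
  rw [← h]
  change e (algebraMap (C i) (E i) (φ i z)) = 0
  rw [hz, map_zero, map_zero]

variable [IsIntegrallyClosed A] [IsDomain D] [Algebra A F] [IsScalarTower A D F]
  [∀ i, IsDomain (C i)]

theorem exists_minpoly_eq_of_irreducible_of_dvd [Finite ι]
    (hBL : Function.Injective (algebraMap B L)) {α : B}
    (hα : IntermediateField.adjoin K {algebraMap B L α} = ⊤)
    (hAD : Function.Injective (algebraMap A D))
    (φ : ∀ i, D ⊗[A] B →ₐ[D] C i) (hφ : ∀ i, Function.Surjective (φ i))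
    (hinj : ∀ z, (∀ i, φ i z = 0) → z = 0) {g : F[X]} (hg : g.Monic) (hgi : Irreducible g)
    (hgf : g ∣ (minpoly A α).map (algebraMap A F)) :
    ∃ i, minpoly F (algebraMap (C i) (E i) (φ i (1 ⊗ₜ α))) = g := by
  have := Fintype.ofFinite ι
  have : Fact (Irreducible g) := ⟨hgi⟩
  have hDF := IsFractionRing.injective D F
  have hDG : Function.Injective (algebraMap D (AdjoinRoot g)) := by
    rw [IsScalarTower.algebraMap_eq D F (AdjoinRoot g)]
    exact (algebraMap F (AdjoinRoot g)).injective.comp hDF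
  have hAG : Function.Injective (algebraMap A (AdjoinRoot g)) := by
    rw [IsScalarTower.algebraMap_eq A D (AdjoinRoot g)]
    exact hDG.comp hAD
  have hroot : Polynomial.aeval (AdjoinRoot.root g) (minpoly A α) = 0 := by
    rw [← Polynomial.aeval_map_algebraMap F, AdjoinRoot.aeval_eq, AdjoinRoot.mk_eq_zero]
    exact hgf
  obtain ⟨β, hβ⟩ := exists_algHom_apply_eq (K := K) hBL hα hAG hroot
  let ψ : D ⊗[A] B →ₐ[D] AdjoinRoot g :=
    Algebra.TensorProduct.productLeftAlgHom (Algebra.ofId D (AdjoinRoot g)) β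
  have hψ : ψ (1 ⊗ₜ α) = AdjoinRoot.root g := by simp [ψ, hβ]
  have hle : Finset.univ.inf (fun j => RingHom.ker (φ j)) ≤ RingHom.ker ψ := fun z hz => by
    rw [hinj z fun j => Submodule.mem_finsetInf.1 hz j (Finset.mem_univ j)]
    exact zero_mem _
  obtain ⟨i, -, hi⟩ := (Ideal.IsPrime.inf_le' (RingHom.ker_isPrime ψ)).1 hle
  let χ : C i →ₐ[D] AdjoinRoot g := AlgHom.liftOfSurjective (φ i) (hφ i) ψ hi
  have hχφ : ∀ z, χ (φ i z) = ψ z := fun z => AlgHom.liftOfSurjective_apply ..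
  have : Algebra.IsIntegral D (C i) := Algebra.IsIntegral.of_surjective (φ i) (hφ i)
  -- In a domain integral over `D` a nonzero ideal meets `D` nontrivially, while `ker χ` meets it in
  -- zero because `D` embeds in `AdjoinRoot g`.
  have hχ : Function.Injective χ := by
    refine (RingHom.injective_iff_ker_eq_bot χ.toRingHom).2 (Ideal.eq_bot_of_comap_eq_bot (R := D) ?_)
    refine (Submodule.eq_bot_iff _).2 fun d hd => hDG ?_
    rw [map_zero, ← χ.commutes]
    exact hd
  let ε₀ : E i →ₐ[D] AdjoinRoot g := IsFractionRing.liftAlgHom (K := E i) hχ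
  have hε₀ : ∀ c, ε₀ (algebraMap (C i) (E i) c) = χ c := fun c =>
    IsFractionRing.lift_algebraMap hχ c
  let ε : E i →ₐ[F] AdjoinRoot g :=
    { ε₀.toRingHom with
      commutes' := fun x => by
        obtain ⟨a, b, -, rfl⟩ := IsFractionRing.div_surjective (A := D) x
        change ε₀ _ = _
        simp only [map_div₀, ← IsScalarTower.algebraMap_apply, AlgHom.commutes] }
  refine ⟨i, ?_⟩
  rw [← minpoly.algHom_eq ε ε.toRingHom.injective]
  change minpoly F (ε₀ _) = g
  rw [hε₀, hχφ, hψ, AdjoinRoot.minpoly_root hgi.ne_zero, hg.leadingCoeff]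
  simp

end Family

/-- A simple extension is the extension adjoining a root of the minimal polynomial. -/
theorem exists_algEquiv_adjoinRoot_minpoly {F E : Type*} [Field F] [Field E] [Algebra F E] {x : E}
    (hx : IsIntegral F x) (h : IntermediateField.adjoin F {x} = ⊤) :
    ∃ e : E ≃ₐ[F] AdjoinRoot (minpoly F x), e x = AdjoinRoot.root (minpoly F x) := by
  let e : AdjoinRoot (minpoly F x) ≃ₐ[F] E :=
    (IntermediateField.adjoinRootEquivAdjoin F hx).trans
      ((IntermediateField.equivOfEq h).trans IntermediateField.topEquiv)
  refine ⟨e.symm, ?_⟩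
  rw [AlgEquiv.symm_apply_eq]
  simp [e, IntermediateField.adjoinRootEquivAdjoin_apply_root]

end BaseChange

end LocalKummerDedekind

-- Assembly of the theorem

attribute [local instance] completionAtAlgebra

theorem mainTheorem3
    {A K L B : Type*}
    [CommRing A] [IsDomain A] [IsLocalRing A] [IsNoetherianRing A] [IsIntegrallyClosed A]
    [Field K] [Algebra A K] [IsFractionRing A K]
    [Field L] [Algebra K L] [Algebra A L] [IsScalarTower A K L]
    [FiniteDimensional K L] [Algebra.IsSeparable K L]
    [CommRing B] [Algebra A B] [Algebra B L] [IsScalarTower A B L] [IsIntegralClosure B A L]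
    [IsDomain (LocalCompletion A)]
    [∀ P : MaximalIdealsOver A B, IsDomain (CompletionAt P)]
    (α : B) (hα : IntermediateField.adjoin K {algebraMap B L α} = ⊤)
    (f : Polynomial (FractionRing (LocalCompletion A)))
    (hf : f = (minpoly A α).map
      (algebraMap A (FractionRing (LocalCompletion A)))) :
    Squarefree f ∧
    ∃ hinj : ∀ P : MaximalIdealsOver A B,
        Function.Injective (toCompletionAt P),
      ∃! Φ : MaximalIdealsOver A B ≃ MonicIrreducibleFactors f,
        ∀ P : MaximalIdealsOver A B,
          ∃ e : FractionRing (CompletionAt P) ≃+* AdjoinRoot (Φ P).1,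
            (∀ x : FractionRing (LocalCompletion A),
              e (IsFractionRing.map (hinj P) x) = AdjoinRoot.of (Φ P).1 x) ∧
            e (algebraMap B (FractionRing (CompletionAt P)) α) =
              AdjoinRoot.root (Φ P).1 := by
  subst hf
  have hBL : Function.Injective (algebraMap B L) := IsIntegralClosure.algebraMap_injective B A L
  have : Module.Finite A B := IsIntegralClosure.finite A K L B
  have hAD : Function.Injective (algebraMap A (LocalCompletion A)) :=
    AdicCompletion.of_injective (IsLocalRing.maximalIdeal A) A
  have hAF : Function.Injective (algebraMap A (FractionRing (LocalCompletion A))) := by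
    rw [IsScalarTower.algebraMap_eq A (LocalCompletion A)]
    exact (IsFractionRing.injective (LocalCompletion A)
      (FractionRing (LocalCompletion A))).comp hAD
  have htf := isTorsionFree_tensorProduct_of_flat (A := A) (K := K) hBL (D := LocalCompletion A)
  have hinj : ∀ P : MaximalIdealsOver A B, Function.Injective (toCompletionAt P) :=
    algebraMap_injective_of_iInf_ker_eq_bot tensorToCompletionAt
      eq_zero_of_forall_tensorToCompletionAt_eq_zero
      fun _ _ => eq_of_ker_tensorToCompletionAt_le
  refine ⟨squarefree_map_minpoly (K := K) hBL α hAF, hinj, ?_⟩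
  let _ : ∀ P : MaximalIdealsOver A B,
      Algebra (FractionRing (LocalCompletion A)) (FractionRing (CompletionAt P)) :=
    fun P => (IsFractionRing.map (hinj P)).toAlgebra
  have (P : MaximalIdealsOver A B) : IsScalarTower (LocalCompletion A)
      (FractionRing (LocalCompletion A)) (FractionRing (CompletionAt P)) :=
    IsScalarTower.of_algebraMap_eq fun d =>
      (IsScalarTower.algebraMap_apply (LocalCompletion A) (CompletionAt P) _ d).trans
        (IsLocalization.map_eq (S := FractionRing (LocalCompletion A))
          (Q := FractionRing (CompletionAt P)) (g := toCompletionAt P)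
          (nonZeroDivisors_le_comap_nonZeroDivisors_of_injective _ (hinj P)) d).symm
  have hx : ∀ P : MaximalIdealsOver A B, algebraMap B (FractionRing (CompletionAt P)) α =
      algebraMap (CompletionAt P) (FractionRing (CompletionAt P))
        (tensorToCompletionAt P (1 ⊗ₜ α)) := fun P => by
    rw [tensorToCompletionAt_one_tmul, ← IsScalarTower.algebraMap_apply]
  have hint (P : MaximalIdealsOver A B) : IsIntegral (FractionRing (LocalCompletion A))
      (algebraMap B (FractionRing (CompletionAt P)) α) :=
    hx P ▸ isIntegral_algebraMap_apply_one_tmul (tensorToCompletionAt P) α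
  let g : MaximalIdealsOver A B → MonicIrreducibleFactors
      ((minpoly A α).map (algebraMap A (FractionRing (LocalCompletion A)))) := fun P =>
    ⟨minpoly (FractionRing (LocalCompletion A))
      (algebraMap B (FractionRing (CompletionAt P)) α),
      minpoly.monic (hint P), minpoly.irreducible (hint P),
      hx P ▸ minpoly_dvd_map_minpoly (tensorToCompletionAt P) α⟩
  have hg : Function.Bijective g := by
    refine ⟨fun P Q h => ?_, fun ⟨q, hq, hqi, hqf⟩ => ?_⟩
    · refine minpoly_injective_of_ker_le (F := FractionRing (LocalCompletion A))
        (E := fun P => FractionRing (CompletionAt P)) hBL hα hAD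
        tensorToCompletionAt tensorToCompletionAt_surjective
        (fun _ _ => eq_of_ker_tensorToCompletionAt_le) ?_
      have h' := congrArg Subtype.val h
      simpa only [g, hx] using h'
    · obtain ⟨P, hP⟩ := exists_minpoly_eq_of_irreducible_of_dvd
        (E := fun P => FractionRing (CompletionAt P)) hBL hα hAD
        tensorToCompletionAt tensorToCompletionAt_surjective
        eq_zero_of_forall_tensorToCompletionAt_eq_zero hq hqi hqf
      exact ⟨P, Subtype.ext ((congrArg _ (hx P)).trans hP)⟩
  refine ⟨Equiv.ofBijective g hg, fun P => ?_, fun Ψ hΨ => Equiv.ext fun P => Subtype.ext ?_⟩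
  · obtain ⟨e, he⟩ := exists_algEquiv_adjoinRoot_minpoly (hint P)
      (hx P ▸ adjoin_eq_top_of_surjective hBL hα hAD (tensorToCompletionAt_surjective P))
    exact ⟨e.toRingEquiv, e.commutes, he⟩
  -- Uniqueness: the isomorphism makes the image of `α` a root of the monic irreducible `Ψ P`, which
  -- is therefore its minimal polynomial.
  · obtain ⟨e, he, heα⟩ := hΨ P
    refine minpoly.eq_of_irreducible_of_monic (Ψ P).2.2.1 ?_ (Ψ P).2.1
    let e' : FractionRing (CompletionAt P) ≃ₐ[FractionRing (LocalCompletion A)]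
        AdjoinRoot (Ψ P).1 := AlgEquiv.ofRingEquiv (f := e) he
    refine e'.injective ?_
    rw [map_zero, ← Polynomial.aeval_algHom_apply]
    change Polynomial.aeval (e _) _ = 0
    rw [heα, AdjoinRoot.aeval_eq, AdjoinRoot.mk_self]
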